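/- For $a\in\mathbb{Q}$ let $F_a(x,y)=\left(y,\frac{a+y}{x}\right)$ be the Lyness map, defined for $x\neq 0$. A rational periodic point of $F_a$ of prime period $n\ge 1$ is a point $p\in\mathbb{Q}^2$ such that all iterates $F_a^k(p)$, $k\ge 0$, are defined (that is, every point of the forward orbit has nonzero first coordinate) and $n$ is the least positive integer with $F_a^n(p)=p$. **Proposition.** Let $a\in\mathbb{Q}$. Then $F_a$ does not have both a rational periodic point of prime period $1$ and a rational periodic point of prime period $12$; nor does $F_a$ have both a rational periodic point of prime period $2$ and a rational periodic point of prime period $12$. -/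

import Mathlib

/-- The formula of the Lyness map `F_a(x, y) = (y, (a + y) / x)` on `ℚ × ℚ`. It has its meaning
only at points with `x ≠ 0`; the points used below are those whose whole forward orbit
satisfies this, see `IsLynessPeriodicPoint`. -/
def lynessMap (a : ℚ) (p : ℚ × ℚ) : ℚ × ℚ :=
  (p.2, (a + p.2) / p.1)

/-- `p` is a rational periodic point of `F_a` of prime period `n`: every iterate of `F_a` is
genuinely defined at `p` (no division by zero ever occurs along the orbit), and `n` is the least
positive integer with `F_a^n(p) = p`. The condition `0 < n` is needed since
`Function.minimalPeriod` is `0` at points that are not periodic. -/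
def IsLynessPeriodicPoint (a : ℚ) (n : ℕ) (p : ℚ × ℚ) : Prop :=
  0 < n ∧ (∀ k : ℕ, ((lynessMap a)^[k] p).1 ≠ 0) ∧
    Function.minimalPeriod (lynessMap a) p = n

/-! Each period forces a square condition on a. A fixed point makes 1 + 4a a square, a 2-cycle makes
4a - 3 a square, and a 12-cycle makes (1 - a)(1 + 3a) a square D², with a ≠ 0, 1. For the last
condition, x₀ and x₁₂ are both written as rational functions of the middle pair (x₅, x₆). The
equation x₀ = x₁₂ then factors (`lyness_twelve_identity`) into degenerate factors and a quadratic
whose discriminant is (1 - a)(1 + 3a) up to a square. If that number is not a square, a degenerate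
factor vanishes at every shift of the orbit, and this forces period 2 or 3.

With s = D / (1 - a), the combined conditions are rational points on w² = (5s² - 1)(s² + 3) and w² =
(s² - 13)(s² + 3). The first curve leaves only s² = 1, that is a = 0; the second has no affine
point. Both facts come from infinite descent (`eq_zero_of_add_sixteen_sq`,
`eq_zero_of_sq_sub_thirteen`): two forms that are squares at once give two factorizations of the
same number, and their common refinement gives a smaller pair of the same kind. -/

/-! ### Parity and factorization of integers -/

lemma Int.exists_sq_eq_of_odd {m : ℤ} (h : Odd m) : ∃ j, m ^ 2 = 8 * j + 1 := by
  obtain ⟨k, rfl⟩ := h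
  obtain ⟨i, hi⟩ := Int.even_mul_succ_self k
  exact ⟨i, by linear_combination 4 * hi⟩

lemma Int.exists_sq_eq_of_even {m : ℤ} (h : Even m) : ∃ j, m ^ 2 = 4 * j := by
  obtain ⟨k, rfl⟩ := h
  exact ⟨k ^ 2, by ring⟩

lemma Int.odd_of_isCoprime_of_even {m n : ℤ} (h : IsCoprime m n) (hn : Even n) : Odd m := by
  rw [← Int.not_even_iff_odd]
  intro hm
  have := h.isUnit_of_dvd' hm.two_dvd hn.two_dvd
  norm_num [Int.isUnit_iff] at this

lemma Int.isCoprime_of_forall_prime {a b : ℤ} (h : ∀ p : ℤ, Prime p → p ∣ a → p ∣ b → False) :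
    IsCoprime a b := by
  refine isCoprime_of_prime_dvd ?_ h
  rintro ⟨rfl, rfl⟩
  exact h 2 Int.prime_two (dvd_zero _) (dvd_zero _)

lemma IsCoprime.not_prime_dvd {a b p : ℤ} (h : IsCoprime a b) (hp : Prime p) (ha : p ∣ a)
    (hb : p ∣ b) : False :=
  hp.not_isUnit (h.isUnit_of_dvd' ha hb)

lemma Int.sq_split {s t n : ℤ} (hc : IsCoprime s t) (hs : 0 ≤ s) (ht : 0 ≤ t)
    (h : s * t = n ^ 2) : ∃ α β, s = α ^ 2 ∧ t = β ^ 2 ∧ n = α * β := by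
  obtain ⟨α, hα⟩ := Int.sq_of_isCoprime hc h
  obtain ⟨β, hβ⟩ := Int.sq_of_isCoprime hc.symm (by rw [mul_comm]; exact h)
  have hα' : s = α ^ 2 := by
    rcases hα with hα | hα
    · exact hα
    · nlinarith [sq_nonneg α]
  have hβ' : t = β ^ 2 := by
    rcases hβ with hβ | hβ
    · exact hβ
    · nlinarith [sq_nonneg β]
  have : n ^ 2 = (α * β) ^ 2 := by rw [← h, hα', hβ']; ring
  rcases sq_eq_sq_iff_eq_or_eq_neg.1 this with h | h
  · exact ⟨α, β, hα', hβ', h⟩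
  · exact ⟨-α, β, by rw [hα']; ring, hβ', by rw [h]; ring⟩

lemma Int.prime_mul_sq_split {q s t n : ℤ} (hq : Prime q) (hq0 : 0 < q) (hc : IsCoprime s t)
    (hs : 0 ≤ s) (ht : 0 ≤ t) (h : s * t = q * n ^ 2) :
    (∃ α β, s = α ^ 2 ∧ t = q * β ^ 2 ∧ n = α * β) ∨
      ∃ α β, s = q * α ^ 2 ∧ t = β ^ 2 ∧ n = α * β := by
  rcases hq.dvd_or_dvd (Dvd.intro _ h.symm) with ⟨k, rfl⟩ | ⟨k, rfl⟩
  · right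
    have h' : k * t = n ^ 2 := mul_left_cancel₀ hq0.ne' (by linear_combination h)
    obtain ⟨α, β, rfl, rfl, hn⟩ := Int.sq_split hc.of_mul_left_right
      (nonneg_of_mul_nonneg_right hs hq0) ht h'
    exact ⟨α, β, rfl, rfl, hn⟩
  · left
    have h' : s * k = n ^ 2 := mul_left_cancel₀ hq0.ne' (by linear_combination h)
    obtain ⟨α, β, rfl, rfl, hn⟩ := Int.sq_split hc.of_mul_right_right
      hs (nonneg_of_mul_nonneg_right ht hq0) h'
    exact ⟨α, β, rfl, rfl, hn⟩

/-- Otherwise p² would divide the squarefree `q`. -/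
lemma Int.prime_dvd_of_mul_eq_prime_mul_sq {p q s t n : ℤ} (hp : Prime p) (hq : Prime q)
    (hs : p ∣ s) (ht : p ∣ t) (h : s * t = q * n ^ 2) : p ∣ n := by
  by_contra hn
  have hco : IsCoprime p n := (hp.coprime_iff_not_dvd).2 hn
  have hd : p * p ∣ q * n ^ 2 := h ▸ mul_dvd_mul hs ht
  exact hp.not_isUnit (hq.squarefree p
    ((hco.pow_right.mul_left hco.pow_right).dvd_of_dvd_mul_right hd))

/-- With `a` the gcd of α and γ, two factorizations of one number have a common refinement. This
produces the smaller pair in every descent step. -/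
lemma Int.four_numbers {α β γ δ : ℤ} (h : α * β = γ * δ) (hα : α ≠ 0) :
    ∃ a b c d, α = a * b ∧ γ = a * c ∧ β = c * d ∧ δ = b * d ∧ IsCoprime b c := by
  obtain ⟨b, c, hco, hb, hc⟩ := Int.exists_gcd_one (Int.gcd_pos_of_ne_zero_left γ hα)
  set g : ℤ := (Int.gcd α γ : ℤ)
  have hg : g ≠ 0 := by rintro h0; exact hα (by rw [hb, h0, mul_zero])
  have hco' : IsCoprime b c := Int.isCoprime_iff_gcd_eq_one.2 hco
  have hb0 : b ≠ 0 := by rintro rfl; exact hα (by rw [hb, zero_mul])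
  have h' : b * β = c * δ := by
    apply mul_left_cancel₀ hg
    rw [hb, hc] at h
    linear_combination h
  obtain ⟨d, rfl⟩ := hco'.dvd_of_dvd_mul_left (Dvd.intro _ h')
  refine ⟨g, b, c, d, by rw [hb, mul_comm], by rw [hc, mul_comm], ?_, rfl, hco'⟩
  apply mul_left_cancel₀ hb0
  linear_combination h'

lemma Int.exists_ratio {b c U V : ℤ} (hco : IsCoprime b c) (hc : c ≠ 0)
    (h : b ^ 2 * U = c ^ 2 * V) : ∃ e, U = e * c ^ 2 ∧ V = e * b ^ 2 := by
  obtain ⟨e, rfl⟩ := (hco.pow (m := 2) (n := 2)).symm.dvd_of_dvd_mul_left (Dvd.intro _ h.symm)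
  refine ⟨e, by ring, mul_left_cancel₀ (pow_ne_zero 2 hc) ?_⟩
  linear_combination -h

/-- Bézout for a² and d². It confines the common factor `e` of a descent step to the divisors of 16
or 9. -/
lemma IsCoprime.dvd_of_dvd_mul_sq {a d e N : ℤ} (h : IsCoprime a d) (ha : e ∣ N * a ^ 2)
    (hd : e ∣ N * d ^ 2) : e ∣ N := by
  obtain ⟨x, y, hxy⟩ := h.pow (m := 2) (n := 2)
  have : N = x * (N * a ^ 2) + y * (N * d ^ 2) := by linear_combination -N * hxy
  rw [this]
  exact (ha.mul_left _).add (hd.mul_left _)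

/-! ### Descent for m² - 13n² and m² + 3n² -/

/-- Parity of a pair at which `m² - 13 n²` and `m² + 3 n²` are squares. -/
lemma even_of_sq_sub_thirteen {m n u v : ℤ}
    (hu : m ^ 2 - 13 * n ^ 2 = u ^ 2) (hv : m ^ 2 + 3 * n ^ 2 = v ^ 2) : Even n := by
  by_contra hn
  rw [Int.not_even_iff_odd] at hn
  obtain ⟨i, hi⟩ := Int.exists_sq_eq_of_odd hn
  rcases Int.even_or_odd m with hm | hm
  · obtain ⟨j, hj⟩ := Int.exists_sq_eq_of_even hm
    rcases Int.even_or_odd u with h | h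
    · obtain ⟨l, hl⟩ := Int.exists_sq_eq_of_even h
      omega
    · obtain ⟨l, hl⟩ := Int.exists_sq_eq_of_odd h
      omega
  · obtain ⟨j, hj⟩ := Int.exists_sq_eq_of_odd hm
    rcases Int.even_or_odd u with h | h
    swap
    · obtain ⟨l, hl⟩ := Int.exists_sq_eq_of_odd h
      omega
    rcases Int.even_or_odd v with h' | h'
    swap
    · obtain ⟨l, hl⟩ := Int.exists_sq_eq_of_odd h'
      omega
    obtain ⟨u, rfl⟩ := h.two_dvd
    obtain ⟨v, rfl⟩ := h'.two_dvd
    rw [mul_pow] at hu hv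
    rcases Int.even_or_odd u with h | h
    · obtain ⟨l, hl⟩ := Int.exists_sq_eq_of_even h
      omega
    rcases Int.even_or_odd v with h' | h'
    · obtain ⟨l, hl⟩ := Int.exists_sq_eq_of_even h'
      omega
    -- For the halved u and v, both odd, v² - u² = 4n²: the left side is 0 modulo 8, the right side
    -- 4.
    obtain ⟨l, hl⟩ := Int.exists_sq_eq_of_odd h
    obtain ⟨l', hl'⟩ := Int.exists_sq_eq_of_odd h'
    omega

/-- Half-sum and half-difference of `|x|` and `y` for odd `x`, `y` with `|y| < |x|`. -/
lemma Int.exists_half_sum {x y : ℤ} (hx : Odd x) (hy : Odd y) (h : |y| < |x|) :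
    ∃ s t, 0 ≤ s ∧ 0 ≤ t ∧ s + t = |x| ∧ s - t = y := by
  obtain ⟨i, hi⟩ := odd_abs.2 hx
  obtain ⟨j, hj⟩ := hy
  have := abs_lt.1 h
  exact ⟨i + j + 1, i - j, by omega, by omega, by omega, by omega⟩

/-- One step of the descent: the two factorizations are refined to a smaller solution. -/
lemma sq_sub_thirteen_refine {α β γ δ : ℤ} (hαβ : IsCoprime α β) (h0 : α * β ≠ 0)
    (h : α * β = γ * δ) (hs : α ^ 2 + 13 * β ^ 2 = γ ^ 2 - 3 * δ ^ 2) :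
    ∃ a d u v : ℤ, d ∣ β ∧ IsCoprime a d ∧ a ^ 2 - 13 * d ^ 2 = u ^ 2 ∧
      a ^ 2 + 3 * d ^ 2 = v ^ 2 := by
  obtain ⟨a, b, c, d, rfl, rfl, rfl, rfl, hbc⟩ := Int.four_numbers h (left_ne_zero_of_mul h0)
  have hb0 : b ≠ 0 := by rintro rfl; simp at h0
  have hc0 : c ≠ 0 := by rintro rfl; simp at h0
  have had : IsCoprime a d := hαβ.of_mul_left_left.of_mul_right_right
  -- The refinement turns `hs` into b²(a² + 3d²) = c²(a² - 13d²).
  obtain ⟨e, h₁, h₂⟩ := Int.exists_ratio (U := a ^ 2 + 3 * d ^ 2) (V := a ^ 2 - 13 * d ^ 2)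
    hbc hc0 (by linear_combination hs)
  have he : e ∣ 16 := had.dvd_of_dvd_mul_sq
    ⟨13 * c ^ 2 + 3 * b ^ 2, by linear_combination 13 * h₁ + 3 * h₂⟩
    ⟨c ^ 2 - b ^ 2, by linear_combination h₁ - h₂⟩
  have hpos : 0 < e := by
    have : 0 < e * c ^ 2 := by
      rw [← h₁]
      rcases eq_or_ne a 0 with rfl | ha
      · simp at h0
      · positivity
    exact pos_of_mul_pos_left this (by positivity)
  -- A congruence modulo 8; it removes the non-square divisors 2 and 8 of 16.
  have htwo : ∀ w : ℤ, a ^ 2 + 3 * d ^ 2 ≠ 2 * w ^ 2 := fun w hw => by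
    have hw' : ∃ j, w ^ 2 = 4 * j ∨ w ^ 2 = 8 * j + 1 := by
      rcases Int.even_or_odd w with hw | hw
      · exact (Int.exists_sq_eq_of_even hw).imp fun _ => Or.inl
      · exact (Int.exists_sq_eq_of_odd hw).imp fun _ => Or.inr
    obtain ⟨k, hk⟩ := hw'
    rcases Int.even_or_odd d with hd | hd
    · obtain ⟨i, hi⟩ := Int.exists_sq_eq_of_even hd
      obtain ⟨j, hj⟩ := Int.exists_sq_eq_of_odd (Int.odd_of_isCoprime_of_even had hd)
      omega
    · obtain ⟨i, hi⟩ := Int.exists_sq_eq_of_odd hd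
      rcases Int.even_or_odd a with ha | ha
      · obtain ⟨j, hj⟩ := Int.exists_sq_eq_of_even ha
        omega
      · obtain ⟨j, hj⟩ := Int.exists_sq_eq_of_odd ha
        omega
  have hle : e ≤ 16 := Int.le_of_dvd (by norm_num) he
  have hdβ : d ∣ c * d := dvd_mul_left _ _
  have hcase : e = 1 ∨ e = 2 ∨ e = 4 ∨ e = 8 ∨ e = 16 := by
    clear h₁ h₂
    interval_cases e <;> revert he <;> decide
  rcases hcase with rfl | rfl | rfl | rfl | rfl
  · exact ⟨a, d, b, c, hdβ, had, by linear_combination h₂, by linear_combination h₁⟩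
  · exact absurd h₁ (htwo c)
  · exact ⟨a, d, 2 * b, 2 * c, hdβ, had, by linear_combination h₂, by linear_combination h₁⟩
  · exact absurd (h₁.trans (by ring)) (htwo (2 * c))
  · exact ⟨a, d, 4 * b, 4 * c, hdβ, had, by linear_combination h₂, by linear_combination h₁⟩

/-- `m² - 13 n²` and `m² + 3 n²` are not both squares for coprime `m`, `n` with `n ≠ 0`. -/
theorem eq_zero_of_sq_sub_thirteen (m n u v : ℤ) (hco : IsCoprime m n)
    (hu : m ^ 2 - 13 * n ^ 2 = u ^ 2) (hv : m ^ 2 + 3 * n ^ 2 = v ^ 2) : n = 0 := by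
  induction hN : n.natAbs using Nat.strong_induction_on generalizing m n u v with
  | _ N ih =>
  by_contra hn0
  have hn := even_of_sq_sub_thirteen hu hv
  have hm := Int.odd_of_isCoprime_of_even hco hn
  have hn2 : 0 < n ^ 2 := by positivity
  obtain ⟨n, rfl⟩ := hn.two_dvd
  have hn1 : n ≠ 0 := by rintro rfl; simp at hn0
  obtain ⟨j, hj⟩ := Int.exists_sq_eq_of_odd hm
  have hu' : Odd u := by
    by_contra h
    obtain ⟨k, hk⟩ := Int.exists_sq_eq_of_even (Int.not_odd_iff_even.1 h)
    rw [mul_pow] at hu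
    omega
  have hv' : Odd v := by
    by_contra h
    obtain ⟨k, hk⟩ := Int.exists_sq_eq_of_even (Int.not_odd_iff_even.1 h)
    rw [mul_pow] at hv
    omega
  -- With `n` already halved, st = (m² - u²)/4 = 13n² and xy = (v² - m²)/4 = 3n².
  obtain ⟨s, t, hs0, ht0, hst, hst'⟩ := Int.exists_half_sum hm hu' (sq_lt_sq.1 (by linarith))
  obtain ⟨x, y, hx0, hy0, hxy, hxy'⟩ := Int.exists_half_sum hv' (odd_abs.2 hm)
    (by rw [abs_abs]; exact sq_lt_sq.1 (by linarith))
  have hprod : s * t = 13 * n ^ 2 := by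
    have : (s + t) ^ 2 - (s - t) ^ 2 = 13 * (2 * n) ^ 2 := by
      rw [hst, hst', sq_abs, ← hu]; ring
    linarith
  have hprod' : x * y = 3 * n ^ 2 := by
    have : (x + y) ^ 2 - (x - y) ^ 2 = 3 * (2 * n) ^ 2 := by
      rw [hxy, hxy', sq_abs, sq_abs, ← hv]; ring
    linarith
  have h13 : Prime (13 : ℤ) := Int.prime_iff_natAbs_prime.2 (by norm_num)
  have h3 : Prime (3 : ℤ) := Int.prime_three
  have hcst : IsCoprime s t := Int.isCoprime_of_forall_prime fun p hp h₁ h₂ =>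
    hco.not_prime_dvd hp ((dvd_abs _ _).1 (hst ▸ h₁.add h₂))
      ((Int.prime_dvd_of_mul_eq_prime_mul_sq hp h13 h₁ h₂ hprod).mul_left 2)
  have hcxy : IsCoprime x y := Int.isCoprime_of_forall_prime fun p hp h₁ h₂ =>
    hco.not_prime_dvd hp ((dvd_abs _ _).1 (hxy' ▸ h₁.sub h₂))
      ((Int.prime_dvd_of_mul_eq_prime_mul_sq hp h3 h₁ h₂ hprod').mul_left 2)
  obtain ⟨α, β, hαβ, hnαβ, hmαβ⟩ :
      ∃ α β, IsCoprime α β ∧ n = α * β ∧ |m| = α ^ 2 + 13 * β ^ 2 := by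
    rcases Int.prime_mul_sq_split h13 (by norm_num) hcst hs0 ht0 hprod with
      ⟨α, β, rfl, rfl, rfl⟩ | ⟨α, β, rfl, rfl, rfl⟩
    · refine ⟨α, β, ?_, rfl, hst.symm⟩
      exact (IsCoprime.pow_iff two_pos two_pos).1 hcst.of_mul_right_right
    · refine ⟨β, α, ?_, mul_comm _ _, by rw [← hst, add_comm]⟩
      exact (IsCoprime.pow_iff two_pos two_pos).1 hcst.of_mul_left_right.symm
  obtain ⟨γ, δ, hnγδ, hmγδ⟩ : ∃ γ δ, n = γ * δ ∧ |m| = γ ^ 2 - 3 * δ ^ 2 := by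
    rcases Int.prime_mul_sq_split h3 (by norm_num) hcxy hx0 hy0 hprod' with
      ⟨γ, δ, rfl, rfl, h⟩ | ⟨γ, δ, rfl, rfl, h⟩
    · exact ⟨γ, δ, h, hxy'.symm⟩
    · exfalso
      -- The odd number |m| = α² + 13β² is 1 modulo 4, whereas 3γ² - δ² ≡ -(γ² + δ²) never is.
      have key : ∀ a b c d : ZMod 4, a * b = c * d → a ^ 2 + 13 * b ^ 2 = 3 * c ^ 2 - d ^ 2 →
          (a ^ 2 + 13 * b ^ 2) ^ 2 = 1 → False := by decide
      refine key α β γ δ ?_ ?_ ?_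
      · exact_mod_cast congrArg (Int.cast : ℤ → ZMod 4) (hnαβ.symm.trans h)
      · have := congrArg (Int.cast : ℤ → ZMod 4) (hmαβ.symm.trans hxy'.symm)
        push_cast at this
        exact this
      · have h2 : (α ^ 2 + 13 * β ^ 2) ^ 2 = 4 * (2 * j) + 1 := by
          rw [← hmαβ, sq_abs, hj]; ring
        have := congrArg (Int.cast : ℤ → ZMod 4) h2
        push_cast at this
        rw [this, show (4 : ZMod 4) = 0 from rfl]
        ring
  obtain ⟨a, d, u', v', hd, had, h₁, h₂⟩ := sq_sub_thirteen_refine hαβ (hnαβ ▸ hn1)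
    (hnαβ.symm.trans hnγδ) (hmαβ.symm.trans hmγδ)
  have hdn : d ∣ n := hnαβ ▸ hd.mul_left α
  have hlt : d.natAbs < N := by
    have h := Nat.le_of_dvd (Int.natAbs_pos.2 hn1) (Int.natAbs_dvd_natAbs.2 hdn)
    have := Int.natAbs_pos.2 hn1
    rw [← hN, Int.natAbs_mul]
    simp only [Int.reduceAbs]
    omega
  have := ih _ hlt a d u' v' had h₁ h₂ rfl
  rw [this] at hdn
  exact hn1 (zero_dvd_iff.1 hdn)

/-! ### Descent for Y² + 16κ² and Y² + 25κ² -/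

/-- With g = bd, `hs` becomes b²(Aa² + Dd²) = c²(Ca² + Bd²), where b and c are coprime. The three
uses differ only in the coefficients. -/
lemma Int.refine_factorizations {A B C D p r f g : ℤ} (hpr : IsCoprime p r) (h0 : p * r ≠ 0)
    (h : p * r = f * g) (hs : A * p ^ 2 + D * g ^ 2 = C * f ^ 2 + B * r ^ 2) :
    ∃ a b c d e, p = a * b ∧ f = a * c ∧ r = c * d ∧ IsCoprime a d ∧
      A * a ^ 2 + D * d ^ 2 = e * c ^ 2 ∧ C * a ^ 2 + B * d ^ 2 = e * b ^ 2 := by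
  obtain ⟨a, b, c, d, rfl, rfl, rfl, rfl, hbc⟩ := Int.four_numbers h (left_ne_zero_of_mul h0)
  have hc0 : c ≠ 0 := by rintro rfl; simp at h0
  obtain ⟨e, h₁, h₂⟩ := Int.exists_ratio (U := A * a ^ 2 + D * d ^ 2)
    (V := C * a ^ 2 + B * d ^ 2) hbc hc0 (by linear_combination hs)
  exact ⟨a, b, c, d, e, rfl, rfl, rfl, hpr.of_mul_left_left.of_mul_right_right, h₁, h₂⟩

lemma Int.eq_one_or_three_or_nine {e : ℤ} (h0 : 0 < e) (h : e ∣ 9) : e = 1 ∨ e = 3 ∨ e = 9 := by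
  have := Int.le_of_dvd (by norm_num) h
  interval_cases e <;> revert h <;> decide

/-- -1 is not a square modulo 3. This excludes e = 3 and e = 9 in the descent. -/
lemma IsCoprime.not_three_dvd_add_sq {a d : ℤ} (h : IsCoprime a d) : ¬ 3 ∣ a ^ 2 + d ^ 2 := by
  intro h3
  have key : ∀ x y : ZMod 3, x ^ 2 + y ^ 2 = 0 → x = 0 ∧ y = 0 := by decide
  have h' := (ZMod.intCast_zmod_eq_zero_iff_dvd (a ^ 2 + d ^ 2) 3).2 h3
  push_cast at h'
  obtain ⟨ha, hd⟩ := key _ _ h'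
  exact h.not_prime_dvd Int.prime_three ((ZMod.intCast_zmod_eq_zero_iff_dvd a 3).1 ha)
    ((ZMod.intCast_zmod_eq_zero_iff_dvd d 3).1 hd)

lemma Int.prime_five : Prime (5 : ℤ) := Int.prime_iff_natAbs_prime.2 (by norm_num)

lemma Int.not_dvd_two_of_dvd_odd {p x : ℤ} (hp : Prime p) (hx : Odd x) (h : p ∣ x) : ¬ p ∣ 2 := by
  intro h2
  obtain ⟨k, rfl⟩ := hx
  exact hp.not_dvd_one ((dvd_add_right (h2.mul_right k)).1 h)

lemma Int.dvd_of_prime_dvd_five {p x : ℤ} (hp : Prime p) (h5 : p ∣ 5) (h : p ∣ x) : 5 ∣ x :=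
  ((hp.dvd_prime_iff_associated Int.prime_five).1 h5).symm.dvd.trans h

lemma Int.exists_four_mul_of_even {f g x : ℤ} (hf : Odd f) (h : 4 * x = f * g) :
    ∃ g', g = 4 * g' ∧ x = f * g' := by
  have hco : IsCoprime (4 : ℤ) f := by
    have h2 : IsCoprime (2 : ℤ) f :=
      Int.prime_two.coprime_iff_not_dvd.2 fun h => Int.not_even_iff_odd.2 hf (even_iff_two_dvd.2 h)
    simpa using h2.pow_left (m := 2)
  obtain ⟨g', rfl⟩ := hco.dvd_of_dvd_mul_left (Dvd.intro _ h)
  exact ⟨g', rfl, by linarith⟩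

/-- Refinement gives 5a² + 16d² = ec² with `a`, `c` odd and e dividing 9. Then e ≡ 5 modulo 8, which
fails for 1, 3 and 9. -/
lemma no_five_twist_aux {p q f g : ℤ} (hpq : IsCoprime p q) (h0 : p * q ≠ 0) (h : p * q = f * g)
    (hf : Odd f) (hs : 5 * (p ^ 2 - q ^ 2) = f ^ 2 - 16 * g ^ 2) : False := by
  obtain ⟨a, b, c, d, e, hp, rfl, hq, had, h₁, h₂⟩ :=
    Int.refine_factorizations (A := 5) (B := 5) (C := 1) (D := 16) hpq h0 h
      (by linear_combination hs)
  obtain ⟨ha, hc⟩ := Int.odd_mul.1 hf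
  have h9 : e ∣ 9 := had.dvd_of_dvd_mul_sq
    ⟨5 * c ^ 2 - 16 * b ^ 2, by linear_combination 5 * h₁ - 16 * h₂⟩
    ⟨5 * b ^ 2 - c ^ 2, by linear_combination 5 * h₂ - h₁⟩
  have ha0 : a ≠ 0 := by rintro rfl; simp at ha
  have hpos : 0 < e := by
    have : 0 < e * c ^ 2 := by rw [← h₁]; positivity
    exact pos_of_mul_pos_left this (by positivity)
  obtain ⟨i, hi⟩ := Int.exists_sq_eq_of_odd ha
  obtain ⟨j, hj⟩ := Int.exists_sq_eq_of_odd hc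
  rcases Int.eq_one_or_three_or_nine hpos h9 with rfl | rfl | rfl <;> omega

/-- `a² + d²` and `25 a² + 16 d²` are not both squares when `a` is odd, `d` is even and prime
to `a` and to `5`. -/
lemma no_five_twist {a d b c : ℤ} (had : IsCoprime a d) (ha : Odd a) (hd : Even d)
    (hd5 : ¬ 5 ∣ d) (hc : a ^ 2 + d ^ 2 = c ^ 2) (hb : 25 * a ^ 2 + 16 * d ^ 2 = b ^ 2) :
    False := by
  have hd0 : d ≠ 0 := by rintro rfl; exact hd5 (dvd_zero _)
  have hdsq : 0 < d ^ 2 := by positivity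
  obtain ⟨i, hi⟩ := Int.exists_sq_eq_of_odd ha
  obtain ⟨j, hj⟩ := Int.exists_sq_eq_of_even hd
  have hc' : Odd c := by
    by_contra h
    obtain ⟨k, hk⟩ := Int.exists_sq_eq_of_even (Int.not_odd_iff_even.1 h)
    omega
  have hb' : Odd b := by
    by_contra h
    obtain ⟨k, hk⟩ := Int.exists_sq_eq_of_even (Int.not_odd_iff_even.1 h)
    omega
  have h5a : Odd (5 * a) := Int.odd_mul.2 ⟨by decide, ha⟩
  obtain ⟨s, t, hs0, ht0, hst, hst'⟩ := Int.exists_half_sum hc' ha (sq_lt_sq.1 (by linarith))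
  obtain ⟨x, y, hx0, hy0, hxy, hxy'⟩ := Int.exists_half_sum hb' h5a
    (sq_lt_sq.1 (by rw [mul_pow]; linarith))
  obtain ⟨d, rfl⟩ := hd.two_dvd
  have hprod : s * t = d ^ 2 := by
    have : (s + t) ^ 2 - (s - t) ^ 2 = (2 * d) ^ 2 := by
      rw [hst, hst', sq_abs, ← hc]; ring
    linarith
  have hprod' : x * y = (4 * d) ^ 2 := by
    have : (x + y) ^ 2 - (x - y) ^ 2 = 16 * (2 * d) ^ 2 := by
      rw [hxy, hxy', sq_abs, ← hb]; ring
    linarith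
  have hcst : IsCoprime s t := Int.isCoprime_of_forall_prime fun p hp h₁ h₂ =>
    had.not_prime_dvd hp (hst' ▸ h₁.sub h₂)
      ((hp.dvd_of_dvd_pow (hprod ▸ h₁.mul_right t)).mul_left 2)
  have hcxy : IsCoprime x y := Int.isCoprime_of_forall_prime fun p hp h₁ h₂ => by
    have h5 : p ∣ 5 * a := hxy' ▸ h₁.sub h₂
    have h2 : ¬ p ∣ 2 := Int.not_dvd_two_of_dvd_odd hp h5a h5
    have h4d : p ∣ 2 * (2 * d) := by
      rw [show 2 * (2 * d) = 4 * d by ring]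
      exact hp.dvd_of_dvd_pow (hprod' ▸ h₁.mul_right y)
    have hpd := (hp.dvd_or_dvd h4d).resolve_left h2
    rcases hp.dvd_or_dvd h5 with h | h
    · exact hd5 (Int.dvd_of_prime_dvd_five hp h hpd)
    · exact had.not_prime_dvd hp h hpd
  obtain ⟨p, q, rfl, rfl, rfl⟩ := Int.sq_split hcst hs0 ht0 hprod
  obtain ⟨f, g, rfl, rfl, hfg⟩ := Int.sq_split hcxy hx0 hy0 hprod'
  have hpq : IsCoprime p q := (IsCoprime.pow_iff two_pos two_pos).1 hcst
  have hpq0 : p * q ≠ 0 := by rintro h; simp [h] at hd0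
  rw [← hst'] at hxy'
  -- f² - g² is odd and fg = 4d, so one of f, g is odd and 4 divides the other.
  rcases Int.even_or_odd f with hf | hf
  · have hg : Odd g := by
      rw [← Int.not_even_iff_odd]
      intro hg
      rw [← hst', ← hxy'] at h5a
      exact Int.not_even_iff_odd.2 h5a ((hf.pow_of_ne_zero two_ne_zero).sub
        (hg.pow_of_ne_zero two_ne_zero))
    obtain ⟨f, rfl, h⟩ := Int.exists_four_mul_of_even hg (hfg.trans (mul_comm _ _))
    exact no_five_twist_aux hpq.symm (mul_comm p q ▸ hpq0) ((mul_comm _ _).trans h) hg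
      (by linear_combination hxy')
  · obtain ⟨g, rfl, h⟩ := Int.exists_four_mul_of_even hf hfg
    exact no_five_twist_aux hpq hpq0 h hf (by linear_combination -hxy')

/-- The descent step for the pair of squares `a² + 16 d²`, `a² + 25 d²`. -/
lemma add_sixteen_sq_descent {p r f g k : ℤ} (hk : k ≠ 0) (hpr : IsCoprime p r)
    (hprk : p * r = k) (hfg : f * g = 5 * k) (hp : Odd p)
    (hs : p ^ 2 - 16 * r ^ 2 = f ^ 2 - g ^ 2) (h5 : ¬ 5 ∣ p ^ 2 - 16 * r ^ 2) :
    ∃ a d b c : ℤ, IsCoprime a d ∧ Odd a ∧ Even d ∧ ¬ 5 ∣ a ∧ a ^ 2 + 16 * d ^ 2 = b ^ 2 ∧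
      a ^ 2 + 25 * d ^ 2 = c ^ 2 ∧ d ∣ k := by
  have h0 : p * r ≠ 0 := hprk ▸ hk
  -- If 5 divides g, the original pair of forms returns. If 5 divides f, the pair is a² + d², 25a² +
  -- 16d²: this is the original pair after dividing d by 5, and is impossible when 5 does not divide
  -- d.
  rcases Int.prime_five.dvd_or_dvd (Dvd.intro _ hfg.symm) with ⟨f, rfl⟩ | ⟨g, rfl⟩
  · obtain ⟨a, b, c, d, e, rfl, rfl, rfl, had, h₁, h₂⟩ :=
      Int.refine_factorizations (A := 1) (B := 16) (C := 25) (D := 1) (f := f) (g := g) hpr h0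
        (by linarith) (by linear_combination hs)
    have ha := (Int.odd_mul.1 hp).1
    have ha0 : a ≠ 0 := by rintro rfl; simp at ha
    have h9 : e ∣ 9 := had.dvd_of_dvd_mul_sq
      ⟨b ^ 2 - 16 * c ^ 2, by linear_combination h₂ - 16 * h₁⟩
      ⟨25 * c ^ 2 - b ^ 2, by linear_combination 25 * h₁ - h₂⟩
    have hpos : 0 < e := by
      have : 0 < e * c ^ 2 := by rw [← h₁]; positivity
      exact pos_of_mul_pos_left this (by positivity)
    have h3 : ¬ 3 ∣ e := fun h =>
      had.not_three_dvd_add_sq (by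
        rw [show a ^ 2 + d ^ 2 = e * c ^ 2 by linear_combination h₁]; exact h.mul_right _)
    obtain rfl : e = 1 := by
      rcases Int.eq_one_or_three_or_nine hpos h9 with h | h | h
      · exact h
      · exact absurd (by rw [h]) h3
      · exact absurd (by rw [h]; norm_num) h3
    have hd : Even d := by
      by_contra hd
      obtain ⟨i, hi⟩ := Int.exists_sq_eq_of_odd ha
      obtain ⟨j, hj⟩ := Int.exists_sq_eq_of_odd (Int.not_even_iff_odd.1 hd)
      rcases Int.even_or_odd c with hc | hc
      · obtain ⟨l, hl⟩ := Int.exists_sq_eq_of_even hc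
        omega
      · obtain ⟨l, hl⟩ := Int.exists_sq_eq_of_odd hc
        omega
    by_cases hd5 : 5 ∣ d
    · obtain ⟨d, rfl⟩ := hd5
      have hb5 : 5 ∣ b := Int.prime_five.dvd_of_dvd_pow (n := 2)
        ⟨5 * a ^ 2 + 80 * d ^ 2, by linear_combination -h₂⟩
      obtain ⟨b, rfl⟩ := hb5
      refine ⟨a, d, b, c, had.of_mul_right_right, ha, ?_, ?_, by linarith, by linarith, ?_⟩
      · exact (Int.even_mul.1 hd).resolve_left (by decide)
      · exact fun h => had.not_prime_dvd Int.prime_five h (dvd_mul_right _ _)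
      · rw [← hprk]
        exact Dvd.intro_left (a * b * (c * 5) * 5) (by ring)
    · exact (no_five_twist (c := c) (b := b) had ha hd hd5 (by linarith) (by linarith)).elim
  · obtain ⟨a, b, c, d, e, rfl, rfl, rfl, had, h₁, h₂⟩ :=
      Int.refine_factorizations (A := 1) (B := 16) (C := 1) (D := 25) (f := f) (g := g) hpr h0
        (by linarith) (by linear_combination hs)
    have ha := (Int.odd_mul.1 hp).1
    have ha0 : a ≠ 0 := by rintro rfl; simp at ha
    have h9 : e ∣ 9 := had.dvd_of_dvd_mul_sq
      ⟨25 * b ^ 2 - 16 * c ^ 2, by linear_combination 25 * h₂ - 16 * h₁⟩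
      ⟨c ^ 2 - b ^ 2, by linear_combination h₁ - h₂⟩
    have hpos : 0 < e := by
      have : 0 < e * c ^ 2 := by rw [← h₁]; positivity
      exact pos_of_mul_pos_left this (by positivity)
    have h3 : ¬ 3 ∣ e := fun h =>
      had.not_three_dvd_add_sq (by
        rw [show a ^ 2 + d ^ 2 = e * c ^ 2 - 3 * (8 * d ^ 2) by linear_combination h₁]
        exact (h.mul_right _).sub (dvd_mul_right _ _))
    obtain rfl : e = 1 := by
      rcases Int.eq_one_or_three_or_nine hpos h9 with h | h | h
      · exact h
      · exact absurd (by rw [h]) h3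
      · exact absurd (by rw [h]; norm_num) h3
    refine ⟨a, d, b, c, had, ha, ?_, ?_, by linarith, by linarith, ?_⟩
    · by_contra hd
      obtain ⟨i, hi⟩ := Int.exists_sq_eq_of_odd ha
      obtain ⟨j, hj⟩ := Int.exists_sq_eq_of_odd (Int.not_even_iff_odd.1 hd)
      rcases Int.even_or_odd c with hc | hc
      · obtain ⟨l, hl⟩ := Int.exists_sq_eq_of_even hc
        omega
      · obtain ⟨l, hl⟩ := Int.exists_sq_eq_of_odd hc
        omega
    · rintro ⟨a, rfl⟩
      exact h5 ⟨5 * a ^ 2 * c ^ 2 - 5 * g ^ 2, by linear_combination hs⟩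
    · rw [← hprk]
      exact (dvd_mul_left d c).mul_left _

/-- `Y² + 16 κ²` and `Y² + 25 κ²` are not both squares when `Y` is odd, `κ ≠ 0` is even and
prime to `Y`, and `5` does not divide `Y`. -/
theorem eq_zero_of_add_sixteen_sq (Y κ X Z : ℤ) (hco : IsCoprime Y κ) (hY : Odd Y)
    (hκ : Even κ) (h5 : ¬ 5 ∣ Y) (hX : Y ^ 2 + 16 * κ ^ 2 = X ^ 2)
    (hZ : Y ^ 2 + 25 * κ ^ 2 = Z ^ 2) : κ = 0 := by
  induction hN : κ.natAbs using Nat.strong_induction_on generalizing Y κ X Z with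
  | _ N ih =>
  by_contra hκ0
  have hκ2 : 0 < κ ^ 2 := by positivity
  obtain ⟨i, hi⟩ := Int.exists_sq_eq_of_odd hY
  obtain ⟨j, hj⟩ := Int.exists_sq_eq_of_even hκ
  have hX' : Odd X := by
    by_contra h
    obtain ⟨k, hk⟩ := Int.exists_sq_eq_of_even (Int.not_odd_iff_even.1 h)
    omega
  have hZ' : Odd Z := by
    by_contra h
    obtain ⟨k, hk⟩ := Int.exists_sq_eq_of_even (Int.not_odd_iff_even.1 h)
    omega
  obtain ⟨s, t, hs0, ht0, hst, hst'⟩ := Int.exists_half_sum hX' hY (sq_lt_sq.1 (by linarith))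
  obtain ⟨x, y, hx0, hy0, hxy, hxy'⟩ := Int.exists_half_sum hZ' hY (sq_lt_sq.1 (by linarith))
  obtain ⟨k, rfl⟩ := hκ.two_dvd
  have hk0 : k ≠ 0 := by rintro rfl; simp at hκ0
  have hprod : s * t = (4 * k) ^ 2 := by
    have : (s + t) ^ 2 - (s - t) ^ 2 = 16 * (2 * k) ^ 2 := by
      rw [hst, hst', sq_abs, ← hX]; ring
    linarith
  have hprod' : x * y = (5 * k) ^ 2 := by
    have : (x + y) ^ 2 - (x - y) ^ 2 = 25 * (2 * k) ^ 2 := by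
      rw [hxy, hxy', sq_abs, ← hZ]; ring
    linarith
  have hcst : IsCoprime s t := Int.isCoprime_of_forall_prime fun p hp h₁ h₂ => by
    have hpY : p ∣ Y := hst' ▸ h₁.sub h₂
    have h2 : ¬ p ∣ 2 := Int.not_dvd_two_of_dvd_odd hp hY hpY
    have h4 : p ∣ 2 * (2 * k) := by
      rw [show 2 * (2 * k) = 4 * k by ring]
      exact hp.dvd_of_dvd_pow (hprod ▸ h₁.mul_right t)
    exact hco.not_prime_dvd hp hpY ((hp.dvd_or_dvd h4).resolve_left h2)
  have hcxy : IsCoprime x y := Int.isCoprime_of_forall_prime fun p hp h₁ h₂ => by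
    have hpY : p ∣ Y := hxy' ▸ h₁.sub h₂
    rcases hp.dvd_or_dvd (hp.dvd_of_dvd_pow (hprod' ▸ h₁.mul_right y)) with h | h
    · exact h5 (Int.dvd_of_prime_dvd_five hp h hpY)
    · exact hco.not_prime_dvd hp hpY (h.mul_left 2)
  obtain ⟨p, r, rfl, rfl, hpr⟩ := Int.sq_split hcst hs0 ht0 hprod
  obtain ⟨f, g, rfl, rfl, hfg⟩ := Int.sq_split hcxy hx0 hy0 hprod'
  have hcpr : IsCoprime p r := (IsCoprime.pow_iff two_pos two_pos).1 hcst
  obtain ⟨a, d, b, c, had, ha, hd, ha5, h₁, h₂, hdk⟩ :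
      ∃ a d b c : ℤ, IsCoprime a d ∧ Odd a ∧ Even d ∧ ¬ 5 ∣ a ∧ a ^ 2 + 16 * d ^ 2 = b ^ 2 ∧
      a ^ 2 + 25 * d ^ 2 = c ^ 2 ∧ d ∣ k := by
    -- pr = 4k with p, r coprime, so 4 divides one of them and the other is odd. Exchanging the
    -- roles replaces Y by -Y.
    rcases Int.even_or_odd p with hp | hp
    · have hr := Int.odd_of_isCoprime_of_even hcpr.symm hp
      obtain ⟨p, rfl, h⟩ := Int.exists_four_mul_of_even hr (hpr.trans (mul_comm _ _))
      refine add_sixteen_sq_descent hk0 hcpr.of_mul_left_right.symm h.symm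
        ((mul_comm g f).trans hfg.symm) hr (by linear_combination hxy' - hst') ?_
      rw [show r ^ 2 - 16 * p ^ 2 = -Y by linear_combination -hst', dvd_neg]
      exact h5
    · obtain ⟨r, rfl, h⟩ := Int.exists_four_mul_of_even hp hpr
      refine add_sixteen_sq_descent hk0 hcpr.of_mul_right_right h.symm
        hfg.symm hp (by linear_combination hst' - hxy') ?_
      rw [show p ^ 2 - 16 * r ^ 2 = Y by linear_combination hst']
      exact h5
  have hlt : d.natAbs < N := by
    have h := Nat.le_of_dvd (Int.natAbs_pos.2 hk0) (Int.natAbs_dvd_natAbs.2 hdk)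
    have := Int.natAbs_pos.2 hk0
    rw [← hN, Int.natAbs_mul]
    simp only [Int.reduceAbs]
    omega
  have := ih _ hlt a d b c had ha hd ha5 h₁ h₂ rfl
  rw [this] at hdk
  exact hk0 (zero_dvd_iff.1 hdk)

/-! ### The Lyness recurrence and period 12 -/

/-- Five steps of the Lyness recurrence from `(x, y)` in closed form, for the last two terms. -/
lemma lyness_closed_form {a x y x₂ x₃ x₄ x₅ x₆ x₇ : ℚ}
    (hx : x ≠ 0) (hy : y ≠ 0) (h₂ : x₂ ≠ 0) (h₃ : x₃ ≠ 0) (h₄ : x₄ ≠ 0) (h₅ : x₅ ≠ 0)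
    (e₂ : x₂ * x = a + y) (e₃ : x₃ * y = a + x₂) (e₄ : x₄ * x₂ = a + x₃)
    (e₅ : x₅ * x₃ = a + x₄) (e₆ : x₆ * x₄ = a + x₅) (e₇ : x₇ * x₅ = a + x₆)
    {t₂ t₃ t₄ t₅ t₆ t₇ : ℚ} (d₂ : t₂ = a + y) (d₃ : t₃ = a * x + a + y)
    (d₄ : t₄ = a * x * y + t₃) (d₅ : t₅ = a * y * t₂ + t₄) (d₆ : t₆ = a * t₂ * t₃ + x * t₅)
    (d₇ : t₇ = a * t₃ * t₄ + y * t₆) :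
    t₃ ≠ 0 ∧ t₄ ≠ 0 ∧ t₅ ≠ 0 ∧ x₆ = y * t₆ / (t₃ * t₄) ∧ x₇ = t₂ * t₇ / (x * t₄ * t₅) := by
  -- The tᵢ are the numerators: x₂ = t₂/x, x₃ = t₃/(xy), x₄ = t₄/(yt₂), x₅ = xt₅/(t₂t₃).
  have f₂ : t₂ = x₂ * x := by rw [d₂, e₂]
  have n₂ : t₂ ≠ 0 := by rw [f₂]; positivity
  have f₃ : t₃ = x₃ * x * y := by linear_combination d₃ - e₂ - x * e₃
  have n₃ : t₃ ≠ 0 := by rw [f₃]; positivity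
  have f₄ : t₄ = x₄ * y * t₂ := by
    rw [f₂]; linear_combination d₄ + f₃ - x * y * e₄
  have n₄ : t₄ ≠ 0 := by rw [f₄]; positivity
  have f₅ : t₅ * x = x₅ * t₂ * t₃ := by
    rw [d₅, f₄, f₃]; linear_combination (-t₂ * x * y) * e₅
  have n₅ : t₅ ≠ 0 := by
    intro h
    rw [h, zero_mul] at f₅
    exact absurd f₅.symm (by positivity)
  have f₆ : x₆ * (t₃ * t₄) = y * t₆ := by
    rw [d₆, f₄]; linear_combination (t₂ * t₃ * y) * e₆ - y * f₅
  have g₆ : x₆ = y * t₆ / (t₃ * t₄) := by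
    rw [eq_div_iff (by positivity)]; exact f₆
  refine ⟨n₃, n₄, n₅, g₆, ?_⟩
  rw [eq_div_iff (by positivity), d₇]
  linear_combination (t₂ * t₃ * t₄) * e₇ + t₂ * f₆ + x₇ * t₄ * f₅

/-- The two rational expressions for the terms six steps to the right and five steps to the left
of `(x, y)` agree only where the cleared discriminant condition or a degenerate one holds. -/
lemma lyness_twelve_identity (a x y : ℚ) {t₂ t₃ t₄ t₅ t₆ t₇ s₂ s₃ s₄ s₅ s₆ w : ℚ}
    (d₂ : t₂ = a + y) (d₃ : t₃ = a * x + a + y)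
    (d₄ : t₄ = a * x * y + t₃) (d₅ : t₅ = a * y * t₂ + t₄) (d₆ : t₆ = a * t₂ * t₃ + x * t₅)
    (d₇ : t₇ = a * t₃ * t₄ + y * t₆)
    (c₂ : s₂ = a + x) (c₃ : s₃ = a * y + a + x)
    (c₄ : s₄ = a * y * x + s₃) (c₅ : s₅ = a * x * s₂ + s₄) (c₆ : s₆ = a * s₂ * s₃ + y * s₅)
    (hw : w = (1 - a) * (x * y) + a * (x + 1) * (y + 1) * (x + y + a)) :
    t₂ * t₇ * (s₃ * s₄) - x * s₆ * (x * t₄ * t₅) =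
      -a * ((y + 1) * (x ^ 2 - a - y) *
        (w ^ 2 + (1 - a) ^ 2 * (x * y) * w - a * (1 - a) ^ 3 * (x * y) ^ 2)) := by
  subst d₂ d₃ d₄ d₅ d₆ d₇ c₂ c₃ c₄ c₅ c₆ hw
  ring

/-- If the Lyness recurrence returns after twelve steps, then away from degenerate positions
`(1 - a) (1 + 3 a)` is a square. -/
lemma lyness_square_of_twelve {a : ℚ} (ha : a ≠ 0) (ha1 : a ≠ 1) {x : ℕ → ℚ} (h0 : ∀ k, x k ≠ 0)
    (hrec : ∀ k, x (k + 2) * x k = a + x (k + 1)) (h12 : x 12 = x 0) :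
    x 6 = -1 ∨ x 5 = x 7 ∨ ∃ D : ℚ, D ^ 2 = (1 - a) * (1 + 3 * a) := by
  have hback : ∀ k, x k * x (k + 2) = a + x (k + 1) := fun k => by rw [mul_comm, hrec]
  obtain ⟨-, n₄, n₅, -, e₇⟩ := lyness_closed_form (a := a) (h0 5) (h0 6) (h0 7) (h0 8) (h0 9)
    (h0 10) (hrec 5) (hrec 6) (hrec 7) (hrec 8) (hrec 9) (hrec 10) rfl rfl rfl rfl rfl rfl
  -- The recurrence is reversible, so the same formula run backwards from (x₆, x₅) reaches x₀ one
  -- term earlier. The value for `x₇` is a filler standing for x₋₁.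
  obtain ⟨m₃, m₄, -, e₆, -⟩ := lyness_closed_form (a := a) (x₇ := (a + x 0) / x 1)
    (h0 6) (h0 5) (h0 4) (h0 3) (h0 2) (h0 1)
    (hback 4) (hback 3) (hback 2) (hback 1) (hback 0) (div_mul_cancel₀ _ (h0 1))
    rfl rfl rfl rfl rfl rfl
  have key := lyness_twelve_identity a (x 5) (x 6) rfl rfl rfl rfl rfl rfl rfl rfl rfl rfl rfl rfl
  have h5 := h0 5
  have h6 := h0 6
  rw [e₇, e₆, div_eq_div_iff (by simp [*]) (by simp [*])] at h12
  rw [h12, sub_self] at key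
  have key' := (mul_eq_zero.1 key.symm).resolve_left (neg_ne_zero.2 ha)
  rcases mul_eq_zero.1 key' with h | h
  · rcases mul_eq_zero.1 h with h | h
    · left; linarith
    · right; left
      have := hrec 5
      apply mul_right_cancel₀ h5
      simp only [Nat.reduceAdd] at this
      linear_combination h - this
  · right; right
    have h1 : 1 - a ≠ 0 := sub_ne_zero.2 ha1.symm
    -- w/(xy) is 1 - a plus a times the Lyness invariant (x + 1)(y + 1)(x + y + a)/(xy). The
    -- discriminant of the quadratic in w is (1 - a)³(1 + 3a)(xy)², whence the witness below.
    set w := (1 - a) * (x 5 * x 6) + a * (x 5 + 1) * (x 6 + 1) * (x 5 + x 6 + a)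
    refine ⟨(2 * w + (1 - a) ^ 2 * (x 5 * x 6)) / ((1 - a) * (x 5 * x 6)), ?_⟩
    rw [div_pow, div_eq_iff (by positivity)]
    linear_combination 4 * h

/-- A twelve-periodic solution of the Lyness recurrence that has none of the periods 2, 3, 5, 6
makes `(1 - a) (1 + 3 a)` a square. -/
lemma lyness_square_of_not_small_period {a : ℚ} {x : ℕ → ℚ} (h0 : ∀ k, x k ≠ 0)
    (hrec : ∀ k, x (k + 2) * x k = a + x (k + 1)) (h12 : ∀ k, x (k + 12) = x k)
    (hper : ∀ k d, 0 < d → d < 12 → x (k + d) = x k → x (k + d + 1) ≠ x (k + 1)) :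
    a ≠ 0 ∧ a ≠ 1 ∧ ∃ D : ℚ, D ^ 2 = (1 - a) * (1 + 3 * a) := by
  have ha : a ≠ 0 := by
    rintro rfl
    have key : ∀ k, x (k + 6) = x k := fun k => by
      have step : ∀ k, x (k + 3) = (x k)⁻¹ := fun k => by
        have e₁ := hrec k
        have e₂ := hrec (k + 1)
        rw [zero_add] at e₁ e₂
        refine eq_inv_of_mul_eq_one_left ?_
        apply mul_right_cancel₀ (mul_ne_zero (h0 (k + 1)) (h0 (k + 2)))
        simp only [add_assoc, Nat.reduceAdd] at e₁ e₂ ⊢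
        linear_combination x (k + 3) * x (k + 1) * e₁ + x (k + 1) * e₂
      rw [step (k + 3), step k, inv_inv]
    exact hper 0 6 (by norm_num) (by norm_num) (key 0) (key 1)
  have ha1 : a ≠ 1 := by
    rintro rfl
    have key : ∀ k, x (k + 5) = x k := fun k => by
      have e₁ := hrec k
      have e₂ := hrec (k + 1)
      have e₃ := hrec (k + 2)
      have e₄ := hrec (k + 3)
      have n₀ := h0 k
      have n₁ := h0 (k + 1)
      have n₂ := h0 (k + 2)
      have n₃ := h0 (k + 3)
      simp only [add_assoc, Nat.reduceAdd] at e₁ e₂ e₃ e₄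
      have f₁ := eq_div_of_mul_eq n₀ e₁
      have f₂ := eq_div_of_mul_eq n₁ e₂
      have f₃ := eq_div_of_mul_eq n₂ e₃
      have n₂' : 1 + x (k + 1) ≠ 0 := by rw [← e₁]; positivity
      have n₃' : x k + (1 + x (k + 1)) ≠ 0 := by
        rw [← e₁, show x k + x (k + 2) * x k = x k * (1 + x (k + 2)) by ring, ← e₂]; positivity
      rw [f₂, f₁] at f₃
      rw [f₂] at e₄
      apply mul_right_cancel₀ n₃
      rw [f₂, f₁]
      rw [f₃, f₁] at e₄
      rw [e₄]
      field_simp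
      ring
    exact hper 0 5 (by norm_num) (by norm_num) (key 0) (key 1)
  refine ⟨ha, ha1, ?_⟩
  by_contra hD
  have dich : ∀ k, x (k + 6) = -1 ∨ x (k + 5) = x (k + 7) := fun k => by
    rcases lyness_square_of_twelve (x := fun i => x (k + i)) ha ha1 (fun i => h0 _)
      (fun i => hrec (k + i)) (h12 k) with h | h | h
    exacts [Or.inl h, Or.inr h, absurd h hD]
  -- Two consecutive terms -1 continue as 1 - a, -1, -1: period 3.
  have pair : ∀ j, x j = -1 → x (j + 1) = -1 → False := fun j h₀ h₁ => by
    have e₁ := hrec j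
    have e₂ := hrec (j + 1)
    have e₃ := hrec (j + 2)
    simp only [add_assoc, Nat.reduceAdd] at e₁ e₂ e₃
    rw [h₀, h₁] at e₁
    have f₂ : x (j + 2) = 1 - a := by linarith
    rw [h₁, f₂] at e₂
    have f₃ : x (j + 3) = -1 := by linarith
    rw [f₂, f₃] at e₃
    have f₄ : x (j + 4) = -1 :=
      mul_right_cancel₀ (sub_ne_zero.2 ha1.symm) (by linear_combination e₃)
    exact hper j 3 (by norm_num) (by norm_num) (f₃.trans h₀.symm) (f₄.trans h₁.symm)
  by_cases hj : ∃ j, x (j + 6) = -1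
  -- A term -1 recurs three places later. The dichotomy in between puts another -1 next to one of
  -- the two.
  · obtain ⟨j, h₀⟩ := hj
    have e₁ := hrec (j + 6)
    have e₂ := hrec (j + 7)
    have s₁ := dich (j + 1)
    have s₂ := dich (j + 2)
    simp only [add_assoc, Nat.reduceAdd] at e₁ e₂ s₁ s₂
    rw [h₀] at e₁ s₁
    have f₁ : x (j + 8) = -(a + x (j + 7)) := by linarith
    have f₂ : x (j + 9) = -1 :=
      mul_right_cancel₀ (h0 (j + 7)) (by rw [e₂, f₁]; ring)
    rcases s₁ with h | h
    · exact pair (j + 6) h₀ h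
    · exact pair (j + 8) h.symm f₂
  · push Not at hj
    have e : ∀ k, x (k + 5) = x (k + 7) := fun k => (dich k).resolve_left (hj k)
    exact hper 5 2 (by norm_num) (by norm_num) (e 0).symm (e 1).symm

/-! ### Square conditions on the parameter -/

lemma lynessMap_iterate_eq (a : ℚ) (p : ℚ × ℚ) (k : ℕ) :
    (lynessMap a)^[k] p = (((lynessMap a)^[k] p).1, ((lynessMap a)^[k + 1] p).1) := by
  rw [Function.iterate_succ_apply']
  rfl

lemma IsLynessPeriodicPoint.square_of_twelve {a : ℚ} {q : ℚ × ℚ}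
    (hq : IsLynessPeriodicPoint a 12 q) :
    a ≠ 0 ∧ a ≠ 1 ∧ ∃ D : ℚ, D ^ 2 = (1 - a) * (1 + 3 * a) := by
  obtain ⟨-, h0, hmin⟩ := hq
  have hqper : Function.IsPeriodicPt (lynessMap a) 12 q := by
    rw [← hmin]; exact Function.isPeriodicPt_minimalPeriod _ _
  refine lyness_square_of_not_small_period (x := fun k => ((lynessMap a)^[k] q).1) h0 ?_ ?_ ?_
  · intro k
    have h2 : ((lynessMap a)^[k + 2] q).1 = ((lynessMap a)^[k + 1] q).2 := by
      rw [Function.iterate_succ_apply' _ (k + 1)]; rfl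
    have h1 : ((lynessMap a)^[k + 1] q).2 =
        (a + ((lynessMap a)^[k + 1] q).1) / ((lynessMap a)^[k] q).1 := by
      rw [Function.iterate_succ_apply']; rfl
    simp only [h2, h1]
    exact div_mul_cancel₀ _ (h0 k)
  · intro k
    simp only [Function.iterate_add_apply, hqper.eq]
  · intro k d hd hd12 e₁ e₂
    have h : (lynessMap a)^[d] ((lynessMap a)^[k] q) = (lynessMap a)^[k] q := by
      rw [← Function.iterate_add_apply, add_comm, lynessMap_iterate_eq, e₁, e₂,
        ← lynessMap_iterate_eq]
    have hdvd : Function.minimalPeriod (lynessMap a) ((lynessMap a)^[k] q) ∣ d :=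
      Function.IsPeriodicPt.minimalPeriod_dvd h
    rw [Function.minimalPeriod_apply_iterate (Function.mk_mem_periodicPts (by norm_num) hqper),
      hmin] at hdvd
    exact absurd (Nat.le_of_dvd hd hdvd) (by omega)

lemma IsLynessPeriodicPoint.square_of_one {a : ℚ} {p : ℚ × ℚ}
    (hp : IsLynessPeriodicPoint a 1 p) : ∃ c : ℚ, c ^ 2 = 1 + 4 * a := by
  obtain ⟨-, h0, hmin⟩ := hp
  have hfix : lynessMap a p = p := Function.minimalPeriod_eq_one_iff_isFixedPt.1 hmin
  have hx : p.1 ≠ 0 := h0 0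
  have e₁ : p.2 = p.1 := congrArg Prod.fst hfix
  have e₂ : (a + p.2) / p.1 = p.2 := congrArg Prod.snd hfix
  rw [div_eq_iff hx, e₁] at e₂
  exact ⟨2 * p.1 - 1, by linear_combination (-4) * e₂⟩

/-- A 2-cycle satisfies x² = a + y and y² = a + x with x ≠ y, so x + y = -1 and x is a root of X² +
X + 1 - a. -/
lemma IsLynessPeriodicPoint.square_of_two {a : ℚ} {p : ℚ × ℚ}
    (hp : IsLynessPeriodicPoint a 2 p) : ∃ c : ℚ, c ^ 2 = 4 * a - 3 := by
  obtain ⟨-, h0, hmin⟩ := hp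
  have hper : lynessMap a (lynessMap a p) = p := by
    have := Function.isPeriodicPt_minimalPeriod (lynessMap a) p
    rwa [hmin] at this
  have hx : p.1 ≠ 0 := h0 0
  have hy : p.2 ≠ 0 := h0 1
  have e₁ : (a + p.2) / p.1 = p.1 := congrArg Prod.fst hper
  have e₂ : (a + (a + p.2) / p.1) / p.2 = p.2 := congrArg Prod.snd hper
  have hne : p.1 - p.2 ≠ 0 := fun h => by
    have h' : p.2 = p.1 := by linarith
    have : lynessMap a p = p := by
      refine Prod.ext h' ?_
      change (a + p.2) / p.1 = p.2
      rw [e₁, h']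
    rw [Function.minimalPeriod_eq_one_iff_isFixedPt.2 this] at hmin
    exact absurd hmin (by norm_num)
  rw [e₁, div_eq_iff hy] at e₂
  rw [div_eq_iff hx] at e₁
  have hs : p.1 + p.2 + 1 = 0 := by
    apply mul_left_cancel₀ hne
    linear_combination e₂ - e₁
  exact ⟨2 * p.1 + 1, by linear_combination 4 * hs - 4 * e₁⟩

/-! ### Rational points on the two quartics -/

lemma IsCoprime.dvd_two_of_dvd {m n p : ℤ} (h : IsCoprime m n) (hp : Prime p)
    (hm : p ∣ 16 * m ^ 2) (hn : p ∣ 16 * n ^ 2) : p ∣ 2 :=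
  hp.dvd_of_dvd_pow (n := 4) (by simpa using h.dvd_of_dvd_mul_sq hm hn)

lemma Int.exists_eq_four_mul_of_mul_eq {U V w : ℤ} (h : 4 * U * (4 * V) = w ^ 2) :
    ∃ z, U * V = z ^ 2 := by
  have h4 : (4 : ℤ) ∣ w := (Int.pow_dvd_pow_iff two_ne_zero).1
    ⟨U * V, by rw [← h]; ring⟩
  obtain ⟨z, rfl⟩ := h4
  exact ⟨z, by linarith⟩

/-- The factors share no odd prime, and congruences force m, n odd, so they are 4A² and 4B². With K
= 2κ, the squares A², m², B², n² are A², A² + 2K, A² + 8K, A² + 10K. For Y = An, then, Y² + 16K² =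
(mB)² and Y² + 25K² = (A² + 5K)², and the descent gives K = 0. -/
theorem sq_eq_sq_of_five_mul_sq_sub {m n w : ℤ} (hco : IsCoprime m n)
    (h : (5 * m ^ 2 - n ^ 2) * (m ^ 2 + 3 * n ^ 2) = w ^ 2) : m ^ 2 = n ^ 2 := by
  have hQ : 0 < m ^ 2 + 3 * n ^ 2 := by
    rcases eq_or_ne m 0 with rfl | hm
    · have : n ≠ 0 := by rintro rfl; exact not_isCoprime_zero_zero hco
      positivity
    · positivity
  have hP : 0 ≤ 5 * m ^ 2 - n ^ 2 := nonneg_of_mul_nonneg_left (h ▸ sq_nonneg w) hQ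
  have htwo : ∀ p : ℤ, Prime p → p ∣ 5 * m ^ 2 - n ^ 2 → p ∣ m ^ 2 + 3 * n ^ 2 → p ∣ 2 := by
    intro p hp h₁ h₂
    refine hco.dvd_two_of_dvd hp ?_ ?_
    · rw [show 16 * m ^ 2 = 3 * (5 * m ^ 2 - n ^ 2) + (m ^ 2 + 3 * n ^ 2) by ring]
      exact (h₁.mul_left 3).add h₂
    · rw [show 16 * n ^ 2 = 5 * (m ^ 2 + 3 * n ^ 2) - (5 * m ^ 2 - n ^ 2) by ring]
      exact (h₂.mul_left 5).sub h₁
  have hsplit : Odd (5 * m ^ 2 - n ^ 2) →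
      ∃ α β, 5 * m ^ 2 - n ^ 2 = α ^ 2 ∧ m ^ 2 + 3 * n ^ 2 = β ^ 2 := fun hodd => by
    obtain ⟨α, β, h₁, h₂, -⟩ := Int.sq_split (Int.isCoprime_of_forall_prime fun p hp h₁ h₂ =>
      Int.not_dvd_two_of_dvd_odd hp hodd h₁ (htwo p hp h₁ h₂)) hP hQ.le h
    exact ⟨α, β, h₁, h₂⟩
  rcases Int.even_or_odd n with hn | hn
  · have hm := Int.odd_of_isCoprime_of_even hco hn
    obtain ⟨α, β, h₁, h₂⟩ := hsplit (((by decide : Odd (5 : ℤ)).mul hm.pow).sub_even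
      (hn.pow_of_ne_zero two_ne_zero))
    obtain ⟨i, hi⟩ := Int.exists_sq_eq_of_odd hm
    have sqr : ∀ x : ℤ, (∃ j, x ^ 2 = 4 * j) ∨ ∃ j, x ^ 2 = 8 * j + 1 := fun x =>
      (Int.even_or_odd x).imp Int.exists_sq_eq_of_even Int.exists_sq_eq_of_odd
    obtain ⟨n, rfl⟩ := hn.two_dvd
    rw [mul_pow] at h₁ h₂
    rcases sqr α with ⟨x, hx⟩ | ⟨x, hx⟩ <;> rcases sqr β with ⟨y, hy⟩ | ⟨y, hy⟩ <;>
      rcases sqr n with ⟨z, hz⟩ | ⟨z, hz⟩ <;> omega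
  obtain ⟨i, hi⟩ := Int.exists_sq_eq_of_odd hn
  rcases Int.even_or_odd m with hm | hm
  · obtain ⟨α, β, h₁, h₂⟩ := hsplit
      (((hm.pow_of_ne_zero two_ne_zero).mul_left 5).sub_odd hn.pow)
    obtain ⟨j, hj⟩ := Int.exists_sq_eq_of_even hm
    rcases Int.even_or_odd α with hα | hα
    · obtain ⟨l, hl⟩ := Int.exists_sq_eq_of_even hα
      omega
    · obtain ⟨l, hl⟩ := Int.exists_sq_eq_of_odd hα
      omega
  obtain ⟨j, hj⟩ := Int.exists_sq_eq_of_odd hm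
  obtain ⟨U, hU⟩ : ∃ U, 5 * m ^ 2 - n ^ 2 = 4 * U := ⟨10 * j - 2 * i + 1, by omega⟩
  obtain ⟨V, hV⟩ : ∃ V, m ^ 2 + 3 * n ^ 2 = 4 * V := ⟨2 * j + 6 * i + 1, by omega⟩
  rw [hU, hV] at h htwo
  obtain ⟨z, hz⟩ := Int.exists_eq_four_mul_of_mul_eq h
  have hUodd : Odd U := ⟨5 * j - i, by omega⟩
  obtain ⟨A, B, rfl, rfl, -⟩ := Int.sq_split (Int.isCoprime_of_forall_prime fun p hp h₁ h₂ =>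
    Int.not_dvd_two_of_dvd_odd hp hUodd h₁ (htwo p hp (h₁.mul_left 4) (h₂.mul_left 4)))
    (by omega) (by omega) hz
  have hA : Odd A := by simpa [Int.odd_pow] using hUodd
  obtain ⟨l, hl⟩ := Int.exists_sq_eq_of_odd hA
  obtain ⟨κ, hκ⟩ : ∃ κ, m ^ 2 = A ^ 2 + 2 * (2 * κ) := ⟨2 * (j - l), by omega⟩
  obtain ⟨Z, hZ⟩ : ∃ Z, A ^ 2 + n ^ 2 = 2 * Z := ⟨4 * (l + i) + 1, by omega⟩
  have hn2 : n ^ 2 = A ^ 2 + 10 * (2 * κ) := by linarith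
  have hB2 : B ^ 2 = A ^ 2 + 8 * (2 * κ) := by linarith
  have hcoY : IsCoprime (A * n) (2 * κ) := Int.isCoprime_of_forall_prime fun p hp h₁ h₂ => by
    have hpA : p ∣ A ^ 2 := by
      rcases hp.dvd_or_dvd h₁ with h | h
      · exact h.pow two_ne_zero
      · rw [show A ^ 2 = n ^ 2 - 10 * (2 * κ) by linarith]
        exact (h.pow two_ne_zero).sub (h₂.mul_left 10)
    refine hco.not_prime_dvd hp (hp.dvd_of_dvd_pow (n := 2) ?_) (hp.dvd_of_dvd_pow (n := 2) ?_)
    · rw [hκ]; exact hpA.add (h₂.mul_left 2)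
    · rw [hn2]; exact hpA.add (h₂.mul_left 10)
  have h5 : ¬ 5 ∣ A * n := fun h => by
    have hboth : 5 ∣ A ∧ 5 ∣ n := by
      rcases Int.prime_five.dvd_or_dvd h with h | h
      · refine ⟨h, Int.prime_five.dvd_of_dvd_pow (n := 2) ?_⟩
        rw [hn2]
        exact (h.pow two_ne_zero).add (Dvd.intro (2 * (2 * κ)) (by ring))
      · refine ⟨Int.prime_five.dvd_of_dvd_pow (n := 2) ?_, h⟩
        rw [show A ^ 2 = n ^ 2 - 5 * (4 * κ) by linarith]
        exact (h.pow two_ne_zero).sub (dvd_mul_right _ _)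
    obtain ⟨⟨A', rfl⟩, ⟨n', rfl⟩⟩ := hboth
    refine hco.not_prime_dvd Int.prime_five (Int.prime_five.dvd_of_dvd_pow (n := 2) ?_)
      (dvd_mul_right _ _)
    exact ⟨4 * A' ^ 2 + n' ^ 2, by linarith⟩
  have hκ0 := eq_zero_of_add_sixteen_sq (A * n) (2 * κ) (m * B) Z hcoY (Int.odd_mul.2 ⟨hA, hn⟩)
    (even_two_mul κ) h5
    (by rw [mul_pow A, mul_pow m, hB2, hn2, hκ]; ring)
    (by
      have : Z = A ^ 2 + 5 * (2 * κ) := by linarith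
      rw [this, mul_pow, hn2]; ring)
  rw [hκ, hn2, hκ0]
  ring

/-- Either the factors are odd and coprime, or m, n are odd and the factors are 4 times coprime
numbers. Both factors are then squares. -/
theorem eq_zero_of_sq_sub_thirteen_mul {m n w : ℤ} (hco : IsCoprime m n)
    (h : (m ^ 2 - 13 * n ^ 2) * (m ^ 2 + 3 * n ^ 2) = w ^ 2) : n = 0 := by
  have hQ : 0 < m ^ 2 + 3 * n ^ 2 := by
    rcases eq_or_ne m 0 with rfl | hm
    · have : n ≠ 0 := by rintro rfl; exact not_isCoprime_zero_zero hco
      positivity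
    · positivity
  have hP : 0 ≤ m ^ 2 - 13 * n ^ 2 := nonneg_of_mul_nonneg_left (h ▸ sq_nonneg w) hQ
  have htwo : ∀ p : ℤ, Prime p → p ∣ m ^ 2 - 13 * n ^ 2 → p ∣ m ^ 2 + 3 * n ^ 2 → p ∣ 2 := by
    intro p hp h₁ h₂
    refine hco.dvd_two_of_dvd hp ?_ ?_
    · rw [show 16 * m ^ 2 = 3 * (m ^ 2 - 13 * n ^ 2) + 13 * (m ^ 2 + 3 * n ^ 2) by ring]
      exact (h₁.mul_left 3).add (h₂.mul_left 13)
    · rw [show 16 * n ^ 2 = (m ^ 2 + 3 * n ^ 2) - (m ^ 2 - 13 * n ^ 2) by ring]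
      exact h₂.sub h₁
  by_cases hodd : Odd (m ^ 2 - 13 * n ^ 2)
  · obtain ⟨u, v, h₁, h₂, -⟩ := Int.sq_split (Int.isCoprime_of_forall_prime fun p hp h₁ h₂ =>
      Int.not_dvd_two_of_dvd_odd hp hodd h₁ (htwo p hp h₁ h₂)) hP hQ.le h
    exact eq_zero_of_sq_sub_thirteen m n u v hco h₁ h₂
  · rcases Int.even_or_odd n with hn | hn
    · exact absurd (((Int.odd_of_isCoprime_of_even hco hn).pow).sub_even
        ((hn.pow_of_ne_zero two_ne_zero).mul_left 13)) hodd
    rcases Int.even_or_odd m with hm | hm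
    · exact absurd ((hm.pow_of_ne_zero two_ne_zero).sub_odd
        ((by decide : Odd (13 : ℤ)).mul hn.pow)) hodd
    obtain ⟨i, hi⟩ := Int.exists_sq_eq_of_odd hn
    obtain ⟨j, hj⟩ := Int.exists_sq_eq_of_odd hm
    obtain ⟨U, hU⟩ : ∃ U, m ^ 2 - 13 * n ^ 2 = 4 * U := ⟨2 * j - 26 * i - 3, by omega⟩
    obtain ⟨V, hV⟩ : ∃ V, m ^ 2 + 3 * n ^ 2 = 4 * V := ⟨2 * j + 6 * i + 1, by omega⟩
    rw [hU, hV] at h htwo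
    obtain ⟨z, hz⟩ := Int.exists_eq_four_mul_of_mul_eq h
    have hUodd : Odd U := ⟨j - 13 * i - 2, by omega⟩
    obtain ⟨A, B, rfl, rfl, -⟩ := Int.sq_split (Int.isCoprime_of_forall_prime fun p hp h₁ h₂ =>
      Int.not_dvd_two_of_dvd_odd hp hUodd h₁ (htwo p hp (h₁.mul_left 4) (h₂.mul_left 4)))
      (by omega) (by omega) hz
    exact eq_zero_of_sq_sub_thirteen m n (2 * A) (2 * B) hco (by linarith) (by linarith)

/-- The rational points of `w² = (5 s² - 1) (s² + 3)` have `s = ± 1`. -/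
theorem Rat.sq_eq_one_of_five_mul_sq_sub {s w : ℚ}
    (h : (5 * s ^ 2 - 1) * (s ^ 2 + 3) = w ^ 2) : s ^ 2 = 1 := by
  have hd : (s.den : ℚ) ≠ 0 := by exact_mod_cast s.den_nz
  have hs : s * s.den = s.num := Rat.mul_den_eq_num s
  have key : IsSquare (((5 * s.num ^ 2 - (s.den : ℤ) ^ 2) *
      (s.num ^ 2 + 3 * (s.den : ℤ) ^ 2) : ℤ) : ℚ) := by
    refine ⟨w * s.den ^ 2, ?_⟩
    push_cast
    rw [← hs]
    linear_combination (s.den : ℚ) ^ 4 * h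
  obtain ⟨r, hr⟩ := Rat.isSquare_intCast_iff.1 key
  have := sq_eq_sq_of_five_mul_sq_sub s.isCoprime_num_den (hr.trans (sq r).symm)
  have h' : (s.num : ℚ) ^ 2 = (s.den : ℚ) ^ 2 := by exact_mod_cast this
  rw [← hs, mul_pow] at h'
  exact mul_right_cancel₀ (pow_ne_zero 2 hd) (by rw [h', one_mul])

/-- The curve `w² = (s² - 13) (s² + 3)` has no affine rational points. -/
theorem Rat.sq_sub_thirteen_mul_ne_sq (s w : ℚ) : (s ^ 2 - 13) * (s ^ 2 + 3) ≠ w ^ 2 := by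
  intro h
  have hs : s * s.den = s.num := Rat.mul_den_eq_num s
  have key : IsSquare (((s.num ^ 2 - 13 * (s.den : ℤ) ^ 2) *
      (s.num ^ 2 + 3 * (s.den : ℤ) ^ 2) : ℤ) : ℚ) := by
    refine ⟨w * s.den ^ 2, ?_⟩
    push_cast
    rw [← hs]
    linear_combination (s.den : ℚ) ^ 4 * h
  obtain ⟨r, hr⟩ := Rat.isSquare_intCast_iff.1 key
  have := eq_zero_of_sq_sub_thirteen_mul s.isCoprime_num_den (hr.trans (sq r).symm)
  exact s.den_nz (by exact_mod_cast this)

theorem mainTheorem6 (a : ℚ) :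
    ¬ ((∃ p : ℚ × ℚ, IsLynessPeriodicPoint a 1 p) ∧
        (∃ q : ℚ × ℚ, IsLynessPeriodicPoint a 12 q)) ∧
    ¬ ((∃ p : ℚ × ℚ, IsLynessPeriodicPoint a 2 p) ∧
        (∃ q : ℚ × ℚ, IsLynessPeriodicPoint a 12 q)) := by
  constructor
  · rintro ⟨⟨p, hp⟩, q, hq⟩
    obtain ⟨ha, ha1, D, hD⟩ := hq.square_of_twelve
    obtain ⟨c, hc⟩ := hp.square_of_one
    have h1 : 1 - a ≠ 0 := sub_ne_zero.2 ha1.symm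
    -- s = D/(1 - a) parametrizes the conic: s² + 3 = 4/(1 - a), and 1 + 4a = (5s² - 1)/(s² + 3).
    have hs : (D / (1 - a)) ^ 2 = (1 + 3 * a) / (1 - a) := by
      rw [div_pow, hD]; field_simp
    have := Rat.sq_eq_one_of_five_mul_sq_sub (s := D / (1 - a)) (w := 4 * c / (1 - a)) (by
      rw [hs, div_pow, mul_pow, hc]; field_simp; ring)
    rw [hs, div_eq_iff h1] at this
    exact ha (by linarith)
  · rintro ⟨⟨p, hp⟩, q, hq⟩
    obtain ⟨-, ha1, D, hD⟩ := hq.square_of_twelve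
    obtain ⟨c, hc⟩ := hp.square_of_two
    have h1 : 1 - a ≠ 0 := sub_ne_zero.2 ha1.symm
    have hs : (D / (1 - a)) ^ 2 = (1 + 3 * a) / (1 - a) := by
      rw [div_pow, hD]; field_simp
    -- Here 4a - 3 = (s² - 13)/(s² + 3).
    refine Rat.sq_sub_thirteen_mul_ne_sq (D / (1 - a)) (4 * c / (1 - a)) ?_
    rw [hs, div_pow, mul_pow, hc]; field_simp; ring
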